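/- **Theorem.** Consider the $(1:b)$ Walker–Breaker game on a complete graph $K$ with finite vertex set $V$: the players alternate; in each of her moves Walker, standing at a vertex $v$, chooses an edge $vw$ not claimed by Breaker, claims it (if she has not done so before) and moves to $w$; in each of his moves Breaker claims $b$ free edges (all remaining ones if there are fewer than $b$), where an edge is free if neither player has claimed it. A graph property $\mathcal P=\mathcal P(n)$ (for each $n$ a set of graphs on $[n]$) that is monotone increasing is called $(p,\delta)$-resilient, for $p=p(n)\in[0,1]$, if with probability tending to $1$ as $n\to\infty$ the random graph $G\sim\mathcal G_{n,p(n)}$ has the following property: for every $R\subseteq G$ with $d_R(v)\le\delta\, d_G(v)$ for all $v\in[n]$ one has $G\setminus R\in\mathcal P$. Let $0<\varepsilon<10^{-5}$, let $p=p(n)\in[0,1]$, and let $\mathcal P$ be a monotone increasing $(p,4\varepsilon)$-resilient graph property. Then there is $N$ such that the following holds for every $n\ge N$ with $p(n)\ge\frac{\ln n}{\varepsilon n}$, all integers $d,b\ge 0$ with $b\le\frac{\varepsilon}{30(d+1)p(n)}$, every finite vertex set $V$, and every $V_0\subseteq V$ with $|V_0|=n$, identified with $[n]$ by any bijection (for instance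 $V_0=V$). Suppose that a $(1:b)$ Walker–Breaker game on the complete graph on $V$ is in progress, with either player to move next, such that 1. the graph of free edges with both endpoints in $V_0$ has minimum degree at least $(1-\varepsilon)n$; 2. in Walker's current graph (on $V$) any two vertices of $V_0$ are joined by a path of length at most $d$, and Walker's current position is joined to every vertex of $V_0$ by a path of length at most $d$ (the latter follows from the former if the position lies in $V_0$, in particular if $V_0=V$). Then Walker has a strategy for continuing the game such that, after finitely many moves and however Breaker plays, the subgraph of Walker's graph induced on $V_0$ belongs to $\mathcal P(n)$. -/

import Mathlib

noncomputable section

namespace WalkerBreaker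

open Filter Topology

/-- A graph property `𝒫 = 𝒫(n)`: for every `n`, a set of graphs on the vertex set `Fin n`. -/
abbrev GraphProperty : Type := (n : ℕ) → Set (SimpleGraph (Fin n))

/-- `𝒫` is monotone increasing: it is preserved under adding edges. -/
def GraphProperty.IsMonotone (P : GraphProperty) : Prop :=
  ∀ (n : ℕ) (G H : SimpleGraph (Fin n)), G ≤ H → G ∈ P n → H ∈ P n

open Classical in
/-- The graphs `G` on `Fin n` such that `G \ R ∈ 𝒫` for every `R ⊆ G` with
`d_R(v) ≤ δ d_G(v)` for every vertex `v`. -/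
def robustGraphs (P : GraphProperty) (δ : ℝ) (n : ℕ) : Set (SimpleGraph (Fin n)) :=
  {G | ∀ R : SimpleGraph (Fin n), R ≤ G →
    (∀ v, (R.degree v : ℝ) ≤ δ * (G.degree v : ℝ)) → G \ R ∈ P n}

/-- `𝒫` is `(p, δ)`-resilient, `p = p(n)`: the binomial random graph `G(n, p(n))` is
asymptotically almost surely such that `𝒫` survives the deletion of every subgraph `R` with
`d_R(v) ≤ δ d_G(v)` for every vertex `v`. -/
def GraphProperty.IsResilient (P : GraphProperty) (p : ℕ → unitInterval) (δ : ℝ) : Prop :=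
  Tendsto (fun n => SimpleGraph.binomialRandom (Fin n) (p n) (robustGraphs P δ n)) atTop (𝓝 1)

/-- The two players. -/
inductive Player
  | walker
  | breaker

/-- A situation of a Walker-Breaker game played on the edges of the complete graph on `V`:
the edges claimed by Walker, the edges claimed by Breaker, and Walker's current position. -/
structure State (V : Type*) where
  /-- the graph of Walker's edges -/
  W : SimpleGraph V
  /-- the graph of Breaker's edges -/
  B : SimpleGraph V
  /-- the vertex at which Walker currently stands -/
  pos : V

namespace State

variable {V : Type*}

/-- The graph of the free edges, i.e. those claimed by neither player. -/
def free (S : State V) : SimpleGraph V := (S.W ⊔ S.B)ᶜ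

/-- Walker may move along the edge from her position to `w` if Breaker has not claimed it
(she may already own it). -/
def CanWalk (S : State V) (w : V) : Prop := S.pos ≠ w ∧ ¬ S.B.Adj S.pos w

/-- Walker moves to `w` and claims the edge she uses (nothing new if she owns it). -/
def walk (S : State V) (w : V) : State V where
  W := S.W ⊔ SimpleGraph.edge S.pos w
  B := S.B
  pos := w

/-- In one move Breaker claims a set `E` of exactly `b` free edges
(all the free edges, if there are fewer than `b`). -/
def CanClaim (b : ℕ) (S : State V) (E : Finset (Sym2 V)) : Prop :=
  (E : Set (Sym2 V)) ⊆ S.free.edgeSet ∧ E.card = min b S.free.edgeSet.ncard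

/-- Breaker claims the edges in `E`. -/
def claim (S : State V) (E : Finset (Sym2 V)) : State V where
  W := S.W
  B := S.B ⊔ SimpleGraph.fromEdgeSet (E : Set (Sym2 V))
  pos := S.pos

end State

/-- `WalkerWins b Goal q S`: in the `(1 : b)` Walker-Breaker game continued from the situation
`S`, with player `q` to move next, Walker has a strategy that makes her graph satisfy `Goal`
after finitely many moves, whatever Breaker does. A derivation is a winning strategy, written as
a well-founded tree: it names one legal move at every turn of Walker and has one branch for every
legal move at every turn of Breaker. Walker does not win by having no legal move. -/
inductive WalkerWins {V : Type*} (b : ℕ) (Goal : SimpleGraph V → Prop) :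
    Player → State V → Prop
  | done (q : Player) (S : State V) (h : Goal S.W) : WalkerWins b Goal q S
  | walkerMove (S : State V) (w : V) (hw : S.CanWalk w)
      (h : WalkerWins b Goal Player.breaker (S.walk w)) : WalkerWins b Goal Player.walker S
  | breakerMove (S : State V)
      (h : ∀ E : Finset (Sym2 V), S.CanClaim b E → WalkerWins b Goal Player.walker (S.claim E)) :
      WalkerWins b Goal Player.breaker S

/-- `u` and `v` are joined by a path of length at most `d` in `G`. -/
def HasShortPath {V : Type*} (G : SimpleGraph V) (d : ℕ) (u v : V) : Prop :=
  ∃ π : G.Walk u v, π.IsPath ∧ π.length ≤ d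

end WalkerBreaker

end

/-!
Walker pretends to expose the random graph `G(n, p)` pair by pair and tries to claim its edges. In a
round she selects a vertex `v` that still has hidden pairs, walks to `v` along her own edges, and
exposes hidden pairs at `v` until an edge turns up that Breaker does not own; she traverses that
edge at once. A round costs at most `d + 1` moves, in which Breaker gets at most `b (d + 1)` edges.
The only edges of the random graph that Walker misses are the pairs that Breaker owned when they
were exposed. If these are at most a `4 ε` proportion of the edges at every vertex, resilience
applies to the edges Walker missed.

Breaker's degrees are controlled by a box game. The selected vertex is the one that maximizes
`danger`, which compares Breaker's degree at `v` with the number of edges found at `v`, and the sum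
of `exp danger` over the active vertices does not grow (`sum_exp_le_sum_exp`). As long as `v` has
hidden pairs, Breaker's degree at `v` is therefore at most
`ε n + 2 β deg v + O(β log n) ≤ 1.3 ε n`, where `β = ε / (15 p)` and `deg v ≤ 2 n p` is the number
of edges found at `v`. Each vertex thus loses at most about a binomial number with mean `1.3 ε n p`
of edges, and this exceeds `3.6 ε n p` at some vertex with small probability, since
`ε n p ≥ log n`.

No random choices are made in the game: the outcomes of the exposures are chosen by Walker. The
quantity `Exposure.risk` is the conditional mean of a weight that is at least `1` on the bad graphs,
plus, for every vertex, an exponential martingale for the number of lost edges. Its average over the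
two outcomes of an exposure is its value before the exposure, whichever pair is exposed and whether
or not Breaker owns it, so that one outcome does not increase it (`Exposure.exists_risk_le`). It is
less than `1` at the start, hence also at the end, when it is at least `1` unless the exposed graph
is robust with degrees between `0.9 n p` and `2 n p` and every vertex has lost few edges
(`comap_mem_of_invariant`). The induction on the number of hidden pairs is
`walkerWins_of_invariant`.
-/

noncomputable section

open Finset

namespace WalkerBreaker

/-! ### Conditional means of a random set -/

/-- The mean of `f (Y ∪ A)`, where `A` is the random subset of `s` that contains every element
independently with probability `p`: the conditional mean of `f` on a `p`-random set of which
everything outside `s` has been revealed, with `Y` the set of the elements found. -/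
def condMean {ι : Type*} [DecidableEq ι] (p : ℝ) (f : Finset ι → ℝ) (s Y : Finset ι) : ℝ :=
  ∑ A ∈ s.powerset, p ^ #A * (1 - p) ^ (#s - #A) * f (Y ∪ A)

section condMean

variable {ι : Type*} [DecidableEq ι] {p : ℝ}

@[simp]
lemma condMean_empty (f : Finset ι → ℝ) (Y : Finset ι) : condMean p f ∅ Y = f Y := by
  simp [condMean]

lemma condMean_insert (f : Finset ι → ℝ) {s : Finset ι} {e : ι} (he : e ∉ s) (Y : Finset ι) :
    condMean p f (insert e s) Y = (1 - p) * condMean p f s Y + p * condMean p f s (insert e Y) := by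
  unfold condMean
  rw [sum_powerset_insert he, mul_sum, mul_sum]
  congr 1 <;> refine sum_congr rfl fun A hA ↦ ?_
  · have h := card_le_card (mem_powerset.1 hA)
    rw [card_insert_of_notMem he, Nat.succ_sub h, pow_succ]
    ring
  · have h : e ∉ A := fun h ↦ he (mem_powerset.1 hA h)
    rw [card_insert_of_notMem he, card_insert_of_notMem h, Nat.add_sub_add_right, pow_succ,
      insert_union, union_insert]
    ring

lemma condMean_add (f g : Finset ι → ℝ) (s Y : Finset ι) :
    condMean p (fun A ↦ f A + g A) s Y = condMean p f s Y + condMean p g s Y := by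
  simp only [condMean, mul_add, sum_add_distrib]

lemma condMean_sum {κ : Type*} (t : Finset κ) (f : κ → Finset ι → ℝ) (s Y : Finset ι) :
    condMean p (fun A ↦ ∑ k ∈ t, f k A) s Y = ∑ k ∈ t, condMean p (f k) s Y := by
  simp only [condMean, mul_sum]
  exact sum_comm

lemma condMean_const_mul (c : ℝ) (f : Finset ι → ℝ) (s Y : Finset ι) :
    condMean p (fun A ↦ c * f A) s Y = c * condMean p f s Y := by
  simp only [condMean, mul_sum]
  exact sum_congr rfl fun A _ ↦ by ring

/-- The moment generating function of the number of found elements with a given property. -/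
lemma condMean_exp (c : ℝ) (q : ι → Prop) [DecidablePred q] (s Y : Finset ι) (h : Disjoint s Y) :
    condMean p (fun A ↦ Real.exp (c * #{e ∈ A | q e})) s Y =
      Real.exp (c * #{e ∈ Y | q e}) * (1 + p * (Real.exp c - 1)) ^ #{e ∈ s | q e} := by
  induction s using Finset.induction_on generalizing Y with
  | empty => simp
  | insert e s he ih =>
    rw [disjoint_insert_left] at h
    have h' : Disjoint s (insert e Y) := disjoint_insert_right.2 ⟨he, h.2⟩
    rw [condMean_insert _ he, ih Y h.2, ih _ h']
    by_cases hq : q e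
    · rw [filter_insert, filter_insert, if_pos hq, if_pos hq, card_insert_of_notMem (by simp [h.1]),
        card_insert_of_notMem (by simp [he]), pow_succ]
      push_cast
      rw [mul_add, mul_one, Real.exp_add]
      ring
    · rw [filter_insert, filter_insert, if_neg hq, if_neg hq]
      ring

end condMean

/-! ### Exposing a random graph pair by pair -/

/-- A stage of the exposure of a random graph on `V`. -/
structure Exposure (V : Type*) where
  /-- the pairs that have not been exposed yet -/
  hidden : Finset (Sym2 V)
  /-- the edges found so far -/
  found : Finset (Sym2 V)
  /-- the pairs that belonged to Breaker when they were exposed -/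
  blocked : Finset (Sym2 V)

/-- The number of the pairs in `Y` that contain `v`. -/
def incCount {V : Type*} [DecidableEq V] (Y : Finset (Sym2 V)) (v : V) : ℕ := #{e ∈ Y | v ∈ e}

section incCount

variable {V : Type*} [DecidableEq V] {Y Z : Finset (Sym2 V)} {e : Sym2 V} {v : V}

lemma incCount_mono (h : Y ⊆ Z) : incCount Y v ≤ incCount Z v :=
  card_le_card (filter_subset_filter _ h)

lemma incCount_insert_of_mem (he : e ∉ Y) (hv : v ∈ e) :
    incCount (insert e Y) v = incCount Y v + 1 := by
  rw [incCount, filter_insert, if_pos hv, card_insert_of_notMem (by simp [he]), incCount]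

lemma incCount_insert_of_notMem (hv : v ∉ e) : incCount (insert e Y) v = incCount Y v := by
  rw [incCount, filter_insert, if_neg hv, incCount]

end incCount

namespace Exposure

variable {V : Type*} [DecidableEq V]

/-- The exponential weight that controls, at the vertex `v`, the number of the found edges that are
blocked: it is a martingale during the exposure, and if at most `K` pairs at `v` are blocked and at
least `T` of them are found, then it is at least `1`. -/
def lossWeight (p T K : ℝ) (X : Exposure V) (v : V) : ℝ :=
  Real.exp (incCount (X.found ∩ X.blocked) v - T +
    (K - incCount X.blocked v) * Real.log (1 + p * (Real.exp 1 - 1)))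

lemma lossWeight_nonneg (p T K : ℝ) (X : Exposure V) (v : V) : 0 ≤ X.lossWeight p T K v :=
  (Real.exp_pos _).le

/-- An upper bound for the conditional probability that the exposure ends badly. -/
def risk [Fintype V] (p T K : ℝ) (f : Finset (Sym2 V) → ℝ) (X : Exposure V) : ℝ :=
  condMean p f X.hidden X.found + ∑ v, X.lossWeight p T K v

/-- The weight is a martingale when the pair `e` is exposed, whether `e` is blocked or not. -/
lemma lossWeight_average {p : ℝ} (hp : 0 ≤ p) (T K : ℝ) (X : Exposure V) (h : Finset (Sym2 V))
    {e : Sym2 V} (hf : e ∉ X.found) (hb : e ∉ X.blocked) {Q : Finset (Sym2 V)}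
    (hQ : Q = X.blocked ∨ Q = insert e X.blocked) (v : V) :
    (1 - p) * lossWeight p T K ⟨h, X.found, Q⟩ v +
      p * lossWeight p T K ⟨h, insert e X.found, Q⟩ v = lossWeight p T K X v := by
  have hA : 0 < 1 + p * (Real.exp 1 - 1) := by
    have : 1 ≤ Real.exp 1 := Real.one_le_exp zero_le_one
    nlinarith
  have hd : X.found ∩ insert e X.blocked = X.found ∩ X.blocked := by
    rw [inter_insert_of_notMem hf]
  have hd2 : insert e X.found ∩ X.blocked = X.found ∩ X.blocked := by
    rw [insert_inter_of_notMem hb]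
  have hd3 : insert e X.found ∩ insert e X.blocked = insert e (X.found ∩ X.blocked) := by
    rw [← insert_inter_distrib]
  unfold lossWeight
  rcases hQ with rfl | rfl
  · simp only [hd2]
    ring
  · simp only [hd, hd3]
    by_cases hv : v ∈ e
    · rw [incCount_insert_of_mem hb hv, incCount_insert_of_mem (by simp [hf]) hv]
      push_cast
      set L := Real.log (1 + p * (Real.exp 1 - 1)) with hL
      have h1 : Real.exp L = 1 + p * (Real.exp 1 - 1) := Real.exp_log hA
      set a : ℝ := ((incCount (X.found ∩ X.blocked) v : ℕ) : ℝ)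
      set g : ℝ := ((incCount X.blocked v : ℕ) : ℝ)
      have h2 : Real.exp (a - T + (K - g) * L) =
          Real.exp (a - T + (K - (g + 1)) * L) * Real.exp L := by
        rw [← Real.exp_add]; congr 1; ring
      have h3 : Real.exp (a + 1 - T + (K - (g + 1)) * L) =
          Real.exp (a - T + (K - (g + 1)) * L) * Real.exp 1 := by
        rw [← Real.exp_add]; congr 1; ring
      rw [h2, h3, h1]
      ring
    · rw [incCount_insert_of_notMem hv, incCount_insert_of_notMem hv]
      ring

variable [Fintype V]

/-- One of the two outcomes of the exposure of a pair does not increase the risk. -/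
lemma exists_risk_le {p : ℝ} (hp : 0 ≤ p) (hp1 : p ≤ 1) (T K : ℝ) (f : Finset (Sym2 V) → ℝ)
    (X : Exposure V) {e : Sym2 V} (he : e ∈ X.hidden) (hf : e ∉ X.found) (hb : e ∉ X.blocked)
    {Q : Finset (Sym2 V)} (hQ : Q = X.blocked ∨ Q = insert e X.blocked) :
    ∃ Y, (Y = X.found ∨ Y = insert e X.found) ∧
      risk p T K f ⟨X.hidden.erase e, Y, Q⟩ ≤ risk p T K f X := by
  have key : (1 - p) * risk p T K f ⟨X.hidden.erase e, X.found, Q⟩ +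
      p * risk p T K f ⟨X.hidden.erase e, insert e X.found, Q⟩ = risk p T K f X := by
    unfold risk
    conv_rhs => rw [← insert_erase he, condMean_insert _ (notMem_erase e _)]
    rw [← sum_congr rfl fun v _ ↦ lossWeight_average hp T K X (X.hidden.erase e) hf hb hQ v,
      sum_add_distrib, ← mul_sum, ← mul_sum]
    ring
  by_contra! h
  have h1 := h _ (Or.inl rfl)
  have h2 := h _ (Or.inr rfl)
  rcases hp.eq_or_lt with h0 | h0
  · subst h0; linarith
  · nlinarith

/-- Exposing the hidden pairs at `v`, until an edge is found that does not belong to `B`. -/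
lemma exists_exposure_at {p : ℝ} (hp : 0 ≤ p) (hp1 : p ≤ 1) (T K : ℝ) (f : Finset (Sym2 V) → ℝ)
    (B : SimpleGraph V) (v : V) (X : Exposure V) (hd : ∀ e ∈ X.hidden, ¬ e.IsDiag)
    (hf : Disjoint X.hidden X.found) (hb : Disjoint X.hidden X.blocked) :
    ∃ X' : Exposure V, X'.hidden ⊆ X.hidden ∧ X.found ⊆ X'.found ∧
      Disjoint X'.hidden X'.found ∧ Disjoint X'.hidden X'.blocked ∧
      risk p T K f X' ≤ risk p T K f X ∧
      (∀ e ∈ X'.blocked, e ∈ X.blocked ∨ e ∈ X.hidden ∧ e ∈ B.edgeSet) ∧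
      (((∀ e ∈ X'.hidden, v ∉ e) ∧
          ∀ e ∈ X'.found, e ∉ X'.blocked → e ∈ X.found ∧ e ∉ X.blocked) ∨
        ∃ u, u ≠ v ∧ ¬ B.Adj v u ∧ s(v, u) ∈ X.hidden ∧ s(v, u) ∉ X'.hidden ∧
          s(v, u) ∈ X'.found ∧
          ∀ e ∈ X'.found, e ∉ X'.blocked → e = s(v, u) ∨ e ∈ X.found ∧ e ∉ X.blocked) := by
  classical
  induction hk : #X.hidden using Nat.strong_induction_on generalizing X with
  | _ k ih =>
  by_cases hv : ∀ e ∈ X.hidden, v ∉ e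
  · exact ⟨X, subset_rfl, subset_rfl, hf, hb, le_rfl, fun e h ↦ Or.inl h,
      Or.inl ⟨hv, fun e h h' ↦ ⟨h, h'⟩⟩⟩
  push Not at hv
  obtain ⟨e, he, hve⟩ := hv
  obtain ⟨u, rfl⟩ := Sym2.mem_iff_exists.1 hve
  set e := s(v, u) with he_def
  have huv : u ≠ v := fun h ↦ hd _ he (by simp [he_def, h])
  have hef : e ∉ X.found := disjoint_left.1 hf he
  have heb : e ∉ X.blocked := disjoint_left.1 hb he
  set Q := if B.Adj v u then insert e X.blocked else X.blocked with hQ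
  obtain ⟨Y, hY, hrisk⟩ := exists_risk_le hp hp1 T K f X he hef heb (Q := Q)
    (by rw [hQ]; split_ifs <;> simp)
  have hYsub : X.found ⊆ Y := by rcases hY with rfl | rfl <;> simp
  have hQsub : X.blocked ⊆ Q := by rw [hQ]; split_ifs <;> simp
  have hYi : Y ⊆ insert e X.found := by rcases hY with rfl | rfl <;> simp
  have hQi : Q ⊆ insert e X.blocked := by rw [hQ]; split_ifs <;> simp
  have hf' : Disjoint (X.hidden.erase e) Y := by
    rw [disjoint_left] at hf ⊢
    intro x hx hxY
    rcases mem_insert.1 (hYi hxY) with h | h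
    · exact (mem_erase.1 hx).1 h
    · exact hf (mem_erase.1 hx).2 h
  have hb' : Disjoint (X.hidden.erase e) Q := by
    rw [disjoint_left] at hb ⊢
    intro x hx hxY
    rcases mem_insert.1 (hQi hxY) with h | h
    · exact (mem_erase.1 hx).1 h
    · exact hb (mem_erase.1 hx).2 h
  have hQB : ∀ x ∈ Q, x ∈ X.blocked ∨ x ∈ X.hidden ∧ x ∈ B.edgeSet := by
    intro x hx
    rw [hQ] at hx
    split_ifs at hx with hB
    · rcases mem_insert.1 hx with rfl | h
      · exact Or.inr ⟨he, hB⟩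
      · exact Or.inl h
    · exact Or.inl hx
  by_cases hfree : e ∈ Y ∧ ¬ B.Adj v u
  · refine ⟨⟨X.hidden.erase e, Y, Q⟩, erase_subset _ _, hYsub, hf', hb', hrisk, hQB,
      Or.inr ⟨u, huv, hfree.2, he, notMem_erase _ _, hfree.1, fun x hx hxQ ↦ ?_⟩⟩
    rcases mem_insert.1 (hYi hx) with h | h
    · exact Or.inl h
    · exact Or.inr ⟨h, fun h' ↦ hxQ (hQsub h')⟩
  -- nothing found that Walker could claim: the exposure at `v` continues
  · have hback : ∀ x ∈ Y, x ∉ Q → x ∈ X.found ∧ x ∉ X.blocked := by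
      intro x hx hxQ
      refine ⟨?_, fun h' ↦ hxQ (hQsub h')⟩
      rcases mem_insert.1 (hYi hx) with rfl | h
      · have hB : B.Adj v u := by tauto
        exact absurd (by simp [hQ, hB]) hxQ
      · exact h
    obtain ⟨X', h1, h2, h3, h4, h5, h6, h7⟩ := ih _ (by rw [← hk]; exact card_erase_lt_of_mem he)
      ⟨X.hidden.erase e, Y, Q⟩ (fun x hx ↦ hd x (mem_erase.1 hx).2) hf' hb' rfl
    refine ⟨X', h1.trans (erase_subset _ _), hYsub.trans h2, h3, h4, h5.trans hrisk, ?_, ?_⟩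
    · intro x hx
      rcases h6 x hx with h | h
      · exact hQB x h
      · exact Or.inr ⟨(mem_erase.1 h.1).2, h.2⟩
    · rcases h7 with h | ⟨w, hw1, hw2, hw3, hw4, hw5, hw6⟩
      · exact Or.inl ⟨h.1, fun x hx hxb ↦ hback x (h.2 x hx hxb).1 (h.2 x hx hxb).2⟩
      · refine Or.inr ⟨w, hw1, hw2, (mem_erase.1 hw3).2, hw4, hw5, fun x hx hxb ↦ ?_⟩
        exact (hw6 x hx hxb).imp_right fun h ↦ hback x h.1 h.2

end Exposure

/-! ### The box game -/

/-- One round of the box game in which the balancing player answers at the box `v` of largest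
exponential weight: the other player adds at most `1 / 4` in total, and the box `v` then loses
`1 / 2` or is discarded. The total weight does not grow. -/
lemma sum_exp_le_sum_exp {ι : Type*} {A A' : Finset ι} (hA : A' ⊆ A) {x x' δ : ι → ℝ} {v : ι}
    (hv : v ∈ A) (hmax : ∀ u ∈ A, x u ≤ x v) (hδ : ∀ u, 0 ≤ δ u) (hsum : ∑ u ∈ A, δ u ≤ 1 / 4)
    (hx : ∀ u ∈ A', x' u ≤ x u + δ u) (hxv : v ∈ A' → x' v ≤ x v + δ v - 1 / 2) :
    ∑ u ∈ A', Real.exp (x' u) ≤ ∑ u ∈ A, Real.exp (x u) := by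
  classical
  set M := Real.exp (x v) with hM
  have hM0 : 0 < M := Real.exp_pos _
  have hδ4 : ∀ u ∈ A, δ u ≤ 1 / 4 := fun u hu ↦
    (single_le_sum (fun w _ ↦ hδ w) hu).trans hsum
  have hexp : ∀ u ∈ A, Real.exp (x u + δ u) ≤ Real.exp (x u) + 5 / 4 * δ u * M := by
    intro u hu
    have h1 : Real.exp (δ u) ≤ 1 + 5 / 4 * δ u := by
      have h2 := hδ4 u hu
      have h3 := hδ u
      have h4 := (abs_le.1 (Real.abs_exp_sub_one_sub_id_le (x := δ u)
        (abs_le.2 ⟨by linarith, by linarith⟩))).2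
      nlinarith
    have h5 : Real.exp (x u) ≤ M := Real.exp_le_exp.2 (hmax u hu)
    have h6 := Real.exp_pos (x u)
    rw [Real.exp_add]
    nlinarith [mul_le_mul_of_nonneg_left h1 h6.le, mul_le_mul_of_nonneg_left h5 (hδ u)]
  have hhalf : Real.exp (-(1 / 2 : ℝ)) ≤ 5 / 8 := by
    have h1 := Real.quadratic_le_exp_of_nonneg (x := 1 / 2) (by norm_num)
    rw [Real.exp_neg, inv_le_comm₀ (Real.exp_pos _) (by norm_num)]
    norm_num at h1 ⊢
    linarith
  have hv' : (if v ∈ A' then Real.exp (x' v) else 0) ≤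
      Real.exp (x v + δ v) - 3 / 8 * M := by
    have h1 : M ≤ Real.exp (x v + δ v) := Real.exp_le_exp.2 (by linarith [hδ v])
    split_ifs with h
    · have h2 : Real.exp (x' v) ≤ Real.exp (x v + δ v) * Real.exp (-(1 / 2 : ℝ)) := by
        rw [← Real.exp_add]
        exact Real.exp_le_exp.2 (by linarith [hxv h])
      nlinarith [mul_le_mul_of_nonneg_left hhalf (Real.exp_pos (x v + δ v)).le]
    · linarith
  have hrest : ∑ u ∈ A.erase v, (if u ∈ A' then Real.exp (x' u) else 0) ≤
      ∑ u ∈ A.erase v, Real.exp (x u + δ u) := by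
    refine sum_le_sum fun u hu ↦ ?_
    split_ifs with h
    · exact Real.exp_le_exp.2 (hx u h)
    · exact (Real.exp_pos _).le
  have hlhs : ∑ u ∈ A', Real.exp (x' u) = ∑ u ∈ A, (if u ∈ A' then Real.exp (x' u) else 0) := by
    rw [← sum_filter, filter_mem_eq_inter, inter_eq_right.2 hA]
  have h1 := sum_le_sum hexp
  rw [sum_add_distrib, ← sum_mul, ← mul_sum] at h1
  have h2 : ∑ u ∈ A, Real.exp (x u + δ u) =
      Real.exp (x v + δ v) + ∑ u ∈ A.erase v, Real.exp (x u + δ u) :=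
    (add_sum_erase A _ hv).symm
  rw [hlhs, ← add_sum_erase A _ hv]
  nlinarith

/-! ### Degrees in Breaker's graph -/

/-- The degree of `v` in Breaker's graph, restricted to the image of `φ`. -/
def breakerDegree {V U : Type*} (φ : V ↪ U) (B : SimpleGraph U) (v : V) : ℕ :=
  ((B.comap φ).neighborSet v).ncard

section breakerDegree

variable {V U : Type*} [Fintype V] (φ : V ↪ U)

lemma breakerDegree_claim_le [DecidableEq U] (B : SimpleGraph U) (E : Finset (Sym2 U)) (v : V) :
    breakerDegree φ (B ⊔ SimpleGraph.fromEdgeSet (E : Set (Sym2 U))) v ≤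
      breakerDegree φ B v + incCount E (φ v) := by
  have hsub : ((B ⊔ SimpleGraph.fromEdgeSet (E : Set (Sym2 U))).comap φ).neighborSet v ⊆
      (B.comap φ).neighborSet v ∪ {u | s(φ v, φ u) ∈ E} := by
    intro u hu
    simp only [SimpleGraph.mem_neighborSet, SimpleGraph.comap_adj, SimpleGraph.sup_adj,
      SimpleGraph.fromEdgeSet_adj, mem_coe] at hu
    rcases hu with h | h
    · exact Or.inl h
    · exact Or.inr h.1
  refine (Set.ncard_le_ncard hsub (Set.toFinite _)).trans ((Set.ncard_union_le _ _).trans ?_)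
  refine Nat.add_le_add_left ?_ _
  rw [incCount, ← Set.ncard_coe_finset]
  refine Set.ncard_le_ncard_of_injOn (fun u ↦ s(φ v, φ u)) ?_ ?_ (Set.toFinite _)
  · intro u hu
    simpa using hu
  · intro u _ w _ h
    exact φ.injective (Sym2.congr_right.1 h)

lemma sum_incCount_le [DecidableEq U] (E : Finset (Sym2 U)) : ∑ v, incCount E (φ v) ≤ 2 * #E := by
  simp only [incCount, card_filter]
  rw [sum_comm, mul_comm, ← smul_eq_mul]
  refine sum_le_card_nsmul _ _ _ fun e _ ↦ ?_
  rw [← card_filter]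
  induction e with
  | _ x y =>
    rw [← card_map φ]
    refine (card_le_card fun z hz ↦ ?_).trans (card_le_two (a := x) (b := y))
    simp only [mem_map, mem_filter, mem_univ, true_and, Sym2.mem_iff] at hz
    obtain ⟨v, hv, rfl⟩ := hz
    simpa using hv

lemma incCount_le_ncard_neighborSet [DecidableEq V] {G : SimpleGraph V} {Q : Finset (Sym2 V)}
    (h : ∀ e ∈ Q, e ∈ G.edgeSet) (v : V) : incCount Q v ≤ (G.neighborSet v).ncard := by
  rw [incCount, ← Set.ncard_coe_finset]
  refine (Set.ncard_le_ncard (t := (fun u ↦ s(v, u)) '' G.neighborSet v) ?_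
    (Set.toFinite _)).trans (Set.ncard_image_le (Set.toFinite _))
  intro e he
  simp only [coe_filter, Set.mem_ofPred_eq] at he
  obtain ⟨u, rfl⟩ := Sym2.mem_iff_exists.1 he.2
  exact ⟨u, h _ he.1, rfl⟩

lemma ncard_neighborSet_le_incCount [DecidableEq V] {G : SimpleGraph V} {Q : Finset (Sym2 V)}
    (h : ∀ e ∈ G.edgeSet, e ∈ Q) (v : V) : (G.neighborSet v).ncard ≤ incCount Q v := by
  rw [incCount, ← Set.ncard_coe_finset]
  refine Set.ncard_le_ncard_of_injOn (fun u ↦ s(v, u)) ?_ ?_ (Set.toFinite _)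
  · intro u hu
    simpa using h s(v, u) hu
  · intro u _ w _ h
    exact Sym2.congr_right.1 h

end breakerDegree

/-! ### Walker's strategy -/

lemma HasShortPath.mono {V : Type*} {G H : SimpleGraph V} (h : G ≤ H) {d : ℕ} {u v : V} :
    HasShortPath G d u v → HasShortPath H d u v := by
  rintro ⟨π, hπ, hd⟩
  exact ⟨π.mapLe h, (SimpleGraph.Walk.isPath_mapLe h).2 hπ, by simpa using hd⟩

lemma State.disjoint_claim {V : Type*} {b : ℕ} {S : State V} (h : Disjoint S.W S.B)
    {E : Finset (Sym2 V)} (hE : S.CanClaim b E) : Disjoint (S.claim E).W (S.claim E).B := by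
  refine disjoint_sup_right.2 ⟨h, ?_⟩
  rw [← SimpleGraph.disjoint_edgeSet, Set.disjoint_left]
  intro e he he'
  have h1 : e ∈ S.free.edgeSet := hE.1 (by
    rw [SimpleGraph.edgeSet_fromEdgeSet] at he'; exact he'.1)
  induction e with
  | _ x y =>
    simp only [State.free, SimpleGraph.mem_edgeSet, SimpleGraph.compl_adj,
      SimpleGraph.sup_adj] at h1
    exact h1.2 (Or.inl he)

/-- Walker can walk along her own edges, and Breaker claims at most `b` edges at every step. -/
lemma walkerWins_of_walk {U : Type*} [DecidableEq U] {b : ℕ} {Goal : SimpleGraph U → Prop}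
    {W : SimpleGraph U}
    {x y : U} (π : W.Walk x y) (B : SimpleGraph U) (hWB : Disjoint W B)
    (h : ∀ E : Finset (Sym2 U), #E ≤ b * π.length →
      Disjoint W (B ⊔ SimpleGraph.fromEdgeSet (E : Set (Sym2 U))) →
        WalkerWins b Goal .walker ⟨W, B ⊔ SimpleGraph.fromEdgeSet (E : Set (Sym2 U)), y⟩) :
    WalkerWins b Goal .walker ⟨W, B, x⟩ := by
  induction π generalizing B with
  | nil => simpa [hWB] using h ∅
  | @cons x z y hxz π ih =>
    refine WalkerWins.walkerMove _ z ⟨hxz.ne, fun hB ↦ ?_⟩ ?_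
    · exact (SimpleGraph.disjoint_left.1 hWB) _ _ hxz hB
    have hW : W ⊔ SimpleGraph.edge x z = W := by
      refine sup_eq_left.2 ?_
      rw [SimpleGraph.edge_le_iff]
      exact Or.inr hxz
    refine WalkerWins.breakerMove _ fun E hE ↦ ?_
    have hdis := State.disjoint_claim (S := State.walk ⟨W, B, x⟩ z) (by simpa [State.walk, hW]) hE
    simp only [State.walk, State.claim, hW] at hdis ⊢
    refine ih _ hdis fun E' hE' hd ↦ ?_
    have hEE : B ⊔ SimpleGraph.fromEdgeSet (E : Set (Sym2 U)) ⊔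
        SimpleGraph.fromEdgeSet (E' : Set (Sym2 U)) =
        B ⊔ SimpleGraph.fromEdgeSet ((E ∪ E' : Finset (Sym2 U)) : Set (Sym2 U)) := by
      rw [sup_assoc, ← SimpleGraph.fromEdgeSet_union, coe_union]
    rw [hEE] at hd ⊢
    refine h _ ((card_union_le _ _).trans ?_) hd
    have : #E ≤ b := hE.2.le.trans (min_le_left _ _)
    rw [SimpleGraph.Walk.length_cons]
    linarith

variable {V U : Type*} [Fintype V] [DecidableEq V]

/-- The vertices that still have hidden pairs. -/
def Exposure.active (X : Exposure V) : Finset V := {v | ∃ e ∈ X.hidden, v ∈ e}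

/-- The danger of the vertex `v`: large if Breaker has many edges at `v` in excess of `a`,
unless Walker has found many edges there. -/
def danger (φ : V ↪ U) (a β : ℝ) (X : Exposure V) (B : SimpleGraph U) (v : V) : ℝ :=
  (breakerDegree φ B v - a - 2 * β * incCount X.found v) / (4 * β)

/-- What Walker maintains at the beginning of every round of her strategy. The last two bounds are
those of the box game: `C` bounds the total weight of the active vertices, so that Breaker's degree
at an active vertex is at most `a + 2 β deg v + 4 β log C`, and the further `β` accounts for the
edges that Breaker claims during a round. -/
structure Invariant (φ : V ↪ U) (d : ℕ) (p T K : ℝ) (f : Finset (Sym2 V) → ℝ) (a β C : ℝ)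
    (X : Exposure V) (S : State U) : Prop where
  disjoint : Disjoint S.W S.B
  path : ∀ u v, HasShortPath S.W d (φ u) (φ v)
  path_pos : ∀ v, HasShortPath S.W d S.pos (φ v)
  not_isDiag : ∀ e ∈ X.hidden, ¬ e.IsDiag
  disjoint_found : Disjoint X.hidden X.found
  disjoint_blocked : Disjoint X.hidden X.blocked
  mem_breaker : ∀ e ∈ X.blocked, e ∈ (S.B.comap φ).edgeSet
  mem_walker : ∀ e ∈ X.found, e ∉ X.blocked → e ∈ (S.W.comap φ).edgeSet
  risk_lt : X.risk p T K f < 1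
  danger_le : ∑ v ∈ X.active, Real.exp (danger φ a β X S.B v) ≤ C
  blocked_le : ∀ v, (incCount X.blocked v : ℝ) ≤
    a + 2 * β * incCount X.found v + (4 * β * Real.log C + β)

/-- The state after a round in which Breaker claims few edges, Walker claims the edges found, and
the most dangerous vertex `v` receives a new edge or ceases to be active. -/
lemma Invariant.next [DecidableEq U] {φ : V ↪ U} {d : ℕ} {p T K : ℝ}
    {f : Finset (Sym2 V) → ℝ} {a β C : ℝ} (hβ : 0 < β)
    {X : Exposure V} {S : State U} (h : Invariant φ d p T K f a β C X S) {v : V}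
    (hv : v ∈ X.active) (hmax : ∀ u ∈ X.active, danger φ a β X S.B u ≤ danger φ a β X S.B v)
    {W B : SimpleGraph U} {y : U} {X' : Exposure V} (hWB : Disjoint W B) (hW : S.W ≤ W)
    (hy : ∀ v, HasShortPath W d y (φ v)) {E : Finset (Sym2 U)}
    (hB : B = S.B ⊔ SimpleGraph.fromEdgeSet (E : Set (Sym2 U))) (hE : 2 * (#E : ℝ) ≤ β)
    (hhid : X'.hidden ⊆ X.hidden) (hfound : X.found ⊆ X'.found)
    (hdf : Disjoint X'.hidden X'.found) (hdb : Disjoint X'.hidden X'.blocked)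
    (hrisk : X'.risk p T K f ≤ X.risk p T K f)
    (hblocked : ∀ e ∈ X'.blocked, e ∈ X.blocked ∨ e ∈ X.hidden ∧ e ∈ (B.comap φ).edgeSet)
    (hw : ∀ e ∈ X'.found, e ∉ X'.blocked → e ∈ (W.comap φ).edgeSet)
    (hprog : v ∈ X'.active → incCount X.found v + 1 ≤ incCount X'.found v) :
    Invariant φ d p T K f a β C X' ⟨W, B, y⟩ := by
  have hact : X'.active ⊆ X.active := by
    intro u hu
    simp only [Exposure.active, mem_filter, mem_univ, true_and] at hu ⊢
    obtain ⟨e, he, hue⟩ := hu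
    exact ⟨e, hhid he, hue⟩
  have hdeg : ∀ u, (breakerDegree φ B u : ℝ) ≤ breakerDegree φ S.B u + incCount E (φ u) := by
    intro u
    rw [hB]
    exact_mod_cast breakerDegree_claim_le φ S.B E u
  have hfm : ∀ u, (incCount X.found u : ℝ) ≤ incCount X'.found u := fun u ↦ by
    exact_mod_cast incCount_mono hfound
  have hsumE : ∑ u, (incCount E (φ u) : ℝ) ≤ β := by
    have := sum_incCount_le φ E
    have h2 : ∑ u, (incCount E (φ u) : ℝ) ≤ 2 * (#E : ℝ) := by exact_mod_cast this
    exact h2.trans hE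
  have hbr : ∀ e ∈ X'.blocked, e ∈ (B.comap φ).edgeSet := by
    intro e he
    rcases hblocked e he with h1 | h1
    · refine SimpleGraph.edgeSet_mono (SimpleGraph.comap_monotone φ ?_) (h.mem_breaker e h1)
      rw [hB]
      exact le_sup_left
    · exact h1.2
  refine ⟨hWB, fun u w ↦ (h.path u w).mono hW, hy, fun e he ↦ h.not_isDiag e (hhid he), hdf, hdb,
    hbr, hw, hrisk.trans_lt h.risk_lt, ?_, ?_⟩
  · refine (sum_exp_le_sum_exp hact (δ := fun u ↦ incCount E (φ u) / (4 * β)) hv hmax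
      (fun u ↦ by positivity) ?_ ?_ ?_).trans h.danger_le
    · rw [← sum_div, div_le_iff₀ (by positivity)]
      refine (sum_le_univ_sum_of_nonneg (fun u ↦ by positivity)).trans ?_
      linarith
    · intro u _
      simp only [danger]
      rw [← add_div]
      refine div_le_div_of_nonneg_right ?_ (by positivity)
      nlinarith [hdeg u, hfm u]
    · intro hv'
      have h1 : (incCount X.found v : ℝ) + 1 ≤ incCount X'.found v := by exact_mod_cast hprog hv'
      have h2 : (1 / 2 : ℝ) = 2 * β / (4 * β) := by field_simp; norm_num
      simp only [danger]
      rw [h2, ← add_div, ← sub_div]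
      refine div_le_div_of_nonneg_right ?_ (by positivity)
      nlinarith [hdeg v]
  · intro u
    by_cases hu : ∃ e ∈ X.hidden, u ∈ e
    -- the pairs at `u` that are blocked by now all belong to Breaker
    · have hu' : u ∈ X.active := by simpa [Exposure.active] using hu
      have h1 : Real.exp (danger φ a β X S.B u) ≤ C :=
        (single_le_sum (fun w _ ↦ (Real.exp_pos (danger φ a β X S.B w)).le) hu').trans h.danger_le
      have h2 : danger φ a β X S.B u ≤ Real.log C := by
        rwa [Real.le_log_iff_exp_le ((Real.exp_pos _).trans_le h1)]
      rw [danger, div_le_iff₀ (by positivity)] at h2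
      have h3 : (incCount X'.blocked u : ℝ) ≤ breakerDegree φ B u := by
        exact_mod_cast incCount_le_ncard_neighborSet hbr u
      have h4 : (incCount E (φ u) : ℝ) ≤ β :=
        (single_le_sum (f := fun u ↦ (incCount E (φ u) : ℝ)) (fun w _ ↦ by positivity)
          (mem_univ u)).trans hsumE
      nlinarith [hdeg u, hfm u]
    · have h1 : incCount X'.blocked u ≤ incCount X.blocked u := by
        refine card_le_card fun e he ↦ ?_
        rw [mem_filter] at he ⊢
        refine ⟨(hblocked e he.1).resolve_right fun h' ↦ hu ⟨e, h'.1, he.2⟩, he.2⟩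
      have h2 : (incCount X'.blocked u : ℝ) ≤ incCount X.blocked u := by exact_mod_cast h1
      nlinarith [h.blocked_le u, hfm u]

/-- Walker wins from every state that satisfies the invariant, provided that the invariant implies
the goal once all pairs have been exposed. -/
theorem walkerWins_of_invariant {φ : V ↪ U} {b d : ℕ} {p T K : ℝ} (hp : 0 ≤ p) (hp1 : p ≤ 1)
    {f : Finset (Sym2 V) → ℝ} {a β C : ℝ} (hβ : 0 < β) (hb : 2 * (b * (d + 1) : ℝ) ≤ β)
    {Goal : SimpleGraph U → Prop}
    (hgoal : ∀ X S, Invariant φ d p T K f a β C X S → X.hidden = ∅ → Goal S.W)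
    (X : Exposure V) (S : State U) (h : Invariant φ d p T K f a β C X S) :
    WalkerWins b Goal .walker S := by
  classical
  induction hk : #X.hidden using Nat.strong_induction_on generalizing X S with
  | _ k ih =>
  by_cases hX : X.hidden = ∅
  · exact .done _ _ (hgoal X S h hX)
  have hne : X.active.Nonempty := by
    obtain ⟨e, he⟩ := nonempty_iff_ne_empty.2 hX
    induction e with
    | _ x y => exact ⟨x, by simpa [Exposure.active] using ⟨_, he, Sym2.mem_mk_left x y⟩⟩
  obtain ⟨v, hv, hmax⟩ := exists_max_image X.active (danger φ a β X S.B) hne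
  obtain ⟨π, -, hπ⟩ := h.path_pos v
  refine walkerWins_of_walk π S.B h.disjoint fun E hE hWB ↦ ?_
  have hEd : #E ≤ b * d := hE.trans (Nat.mul_le_mul_left b hπ)
  set B := S.B ⊔ SimpleGraph.fromEdgeSet (E : Set (Sym2 U)) with hB
  obtain ⟨X', h1, h2, h3, h4, h5, h6, h7⟩ := X.exists_exposure_at hp hp1 T K f (B.comap φ) v
    h.not_isDiag h.disjoint_found h.disjoint_blocked
  rcases h7 with h7 | ⟨u, huv, huB, hu1, hu2, hu3, hu4⟩
  · have hv' : v ∉ X'.active := by simpa [Exposure.active] using h7.1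
    refine ih _ ?_ X' _ (h.next hβ hv hmax hWB le_rfl (h.path v) hB ?_ h1 h2 h3 h4 h5 h6
      (fun e he he' ↦ h.mem_walker e (h7.2 e he he').1 (h7.2 e he he').2)
      fun h' ↦ absurd h' hv') rfl
    · rw [← hk]
      refine card_lt_card ⟨h1, fun hsub ↦ ?_⟩
      simp only [Exposure.active, mem_filter, mem_univ, true_and] at hv
      obtain ⟨e, he, hve⟩ := hv
      exact h7.1 e (hsub he) hve
    · have : (#E : ℝ) ≤ b * d := by exact_mod_cast hEd
      nlinarith [Nat.cast_nonneg (α := ℝ) b]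
  -- the edge found does not belong to Breaker: Walker traverses it
  · have hne : φ v ≠ φ u := fun h' ↦ huv (φ.injective h').symm
    refine .walkerMove _ (φ u) ⟨hne, huB⟩ (.breakerMove _ fun F hF ↦ ?_)
    have hdis := State.disjoint_claim (S := State.walk ⟨S.W, B, φ v⟩ (φ u)) (by
      refine disjoint_sup_left.2 ⟨hWB, ?_⟩
      rw [SimpleGraph.disjoint_left]
      intro x y hxy hxyB
      rw [SimpleGraph.edge_adj] at hxy
      rcases hxy.1 with ⟨rfl, rfl⟩ | ⟨rfl, rfl⟩
      · exact huB hxyB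
      · exact huB hxyB.symm) hF
    have hFB : B ⊔ SimpleGraph.fromEdgeSet (F : Set (Sym2 U)) =
        S.B ⊔ SimpleGraph.fromEdgeSet ((E ∪ F : Finset (Sym2 U)) : Set (Sym2 U)) := by
      rw [hB, sup_assoc, ← SimpleGraph.fromEdgeSet_union, coe_union]
    simp only [State.walk, State.claim] at hdis ⊢
    refine ih _ ?_ X' _ (h.next hβ hv hmax hdis le_sup_left
      (fun w ↦ (h.path u w).mono le_sup_left) hFB ?_ h1 h2 h3 h4 h5 ?_ ?_ ?_) rfl
    · rw [← hk]
      exact card_lt_card ⟨h1, fun hsub ↦ hu2 (hsub hu1)⟩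
    · have hF' : #F ≤ b := hF.2.le.trans (min_le_left _ _)
      have : (#(E ∪ F) : ℝ) ≤ b * (d + 1) := by
        have : #(E ∪ F) ≤ b * (d + 1) := (card_union_le _ _).trans (by linarith)
        exact_mod_cast this
      linarith
    · intro e he
      refine (h6 e he).imp_right fun h' ↦ ⟨h'.1, ?_⟩
      exact SimpleGraph.edgeSet_mono (SimpleGraph.comap_monotone φ le_sup_left) h'.2
    · intro e he he'
      rcases hu4 e he he' with rfl | ⟨h8, h9⟩
      · refine Or.inr ?_
        rw [SimpleGraph.edge_adj]
        exact ⟨Or.inl ⟨rfl, rfl⟩, hne⟩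
      · exact SimpleGraph.edgeSet_mono (SimpleGraph.comap_monotone φ le_sup_left)
          (h.mem_walker e h8 h9)
    · intro _
      have hnot : s(v, u) ∉ X.found := disjoint_left.1 h.disjoint_found hu1
      rw [← incCount_insert_of_mem hnot (Sym2.mem_mk_left v u)]
      exact incCount_mono (insert_subset hu3 h2)

/-! ### The binomial random graph -/

/-- The pairs of distinct vertices. -/
def allPairs (n : ℕ) : Finset (Sym2 (Fin n)) := {e | ¬ e.IsDiag}

lemma incCount_allPairs_add_one {n : ℕ} (v : Fin n) : incCount (allPairs n) v + 1 = n := by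
  have h : ({e ∈ allPairs n | v ∈ e} : Finset _) = (univ.erase v).image (fun u ↦ s(v, u)) := by
    ext e
    simp only [allPairs, mem_filter, mem_univ, true_and, mem_image, mem_erase, and_true]
    constructor
    · rintro ⟨h1, h2⟩
      obtain ⟨u, rfl⟩ := Sym2.mem_iff_exists.1 h2
      exact ⟨u, fun h ↦ h1 (by simp [h]), rfl⟩
    · rintro ⟨u, hu, rfl⟩
      exact ⟨by simpa using hu.symm, Sym2.mem_mk_left v u⟩
  rw [incCount, h, card_image_of_injective _ fun u w h ↦ Sym2.congr_right.1 h,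
    card_erase_add_one (mem_univ v), card_univ, Fintype.card_fin]

lemma measurableSet_of_finite {V : Type*} [Finite V] (A : Set (SimpleGraph V)) :
    MeasurableSet A :=
  SimpleGraph.measurableEmbedding_edgeSet.measurableSet_image.1 (Set.toFinite _).measurableSet

open Classical in
/-- Before any exposure, the conditional probability of `A` is its probability under the law of the
binomial random graph (only this inequality is needed). -/
lemma condMean_indicator_le (n : ℕ) (p : unitInterval) (A : Set (SimpleGraph (Fin n))) :
    condMean (p : ℝ) (fun Y ↦ A.indicator 1 (SimpleGraph.fromEdgeSet (Y : Set (Sym2 (Fin n)))))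
      (allPairs n) ∅ ≤ (SimpleGraph.binomialRandom (Fin n) p).real A := by
  have hco : ((allPairs n : Finset _) : Set (Sym2 (Fin n))) = Sym2.diagSetᶜ := by
    ext e; simp [allPairs]
  have hmeas : MeasurableSet A := measurableSet_of_finite A
  rw [SimpleGraph.binomialRandom_eq_map, MeasureTheory.map_measureReal_apply
    SimpleGraph.measurable_fromEdgeSet hmeas]
  unfold condMean
  simp only [empty_union, Set.indicator_apply, Pi.one_apply, mul_ite, mul_one, mul_zero]
  rw [← sum_filter]
  have hsum : ∀ Y ∈ (allPairs n).powerset.filter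
      (fun Y : Finset (Sym2 (Fin n)) ↦
        SimpleGraph.fromEdgeSet (Y : Set (Sym2 (Fin n))) ∈ A),
      (p : ℝ) ^ #Y * (1 - p : ℝ) ^ (#(allPairs n) - #Y) =
        (ProbabilityTheory.setBernoulli Sym2.diagSetᶜ p).real {(Y : Set (Sym2 (Fin n)))} := by
    intro Y hY
    have hY' : Y ⊆ allPairs n := mem_powerset.1 (mem_filter.1 hY).1
    rw [← hco, ProbabilityTheory.setBernoulli_real_singleton p (by exact_mod_cast hY')
      (Set.toFinite _), ← coe_sdiff, Set.ncard_coe_finset, Set.ncard_coe_finset,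
      card_sdiff_of_subset hY']
  rw [sum_congr rfl hsum, ← MeasureTheory.measureReal_biUnion_finset]
  · refine MeasureTheory.measureReal_mono ?_
    intro Y hY
    simp only [Set.mem_iUnion, Set.mem_singleton_iff] at hY
    obtain ⟨Z, hZ, rfl⟩ := hY
    exact (mem_filter.1 hZ).2
  · intro Y _ Z _ h
    simpa [Function.onFun] using h
  · intro Y _
    exact (Set.toFinite _).measurableSet

/-- A weight that is at least `1` if the graph with edge set `Y` is not in `A` or has a degree
outside `[0.9 x, 2 x]`. -/
def badWeight {n : ℕ} (A : Set (SimpleGraph (Fin n))) (x : ℝ) (Y : Finset (Sym2 (Fin n))) : ℝ :=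
  Aᶜ.indicator 1 (SimpleGraph.fromEdgeSet (Y : Set (Sym2 (Fin n)))) +
    ∑ v, (Real.exp (0.09 * x) * Real.exp (-0.1 * incCount Y v) +
      Real.exp (-2 * x) * Real.exp (1 * incCount Y v))

section badWeight

variable {n : ℕ} {A : Set (SimpleGraph (Fin n))} {x : ℝ} {Y : Finset (Sym2 (Fin n))}

lemma badWeight_nonneg : 0 ≤ badWeight A x Y :=
  add_nonneg (Set.indicator_nonneg (fun _ _ ↦ zero_le_one) _)
    (sum_nonneg fun _ _ ↦ by positivity)

lemma mem_of_badWeight_lt (h : badWeight A x Y < 1) :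
    SimpleGraph.fromEdgeSet (Y : Set (Sym2 (Fin n))) ∈ A := by
  by_contra hA
  have h1 : 0 ≤ ∑ v, (Real.exp (0.09 * x) * Real.exp (-0.1 * incCount Y v) +
      Real.exp (-2 * x) * Real.exp (1 * incCount Y v)) := by positivity
  rw [badWeight, Set.indicator_of_mem (Set.mem_compl hA), Pi.one_apply] at h
  linarith

lemma incCount_bounds_of_badWeight_lt (h : badWeight A x Y < 1) (v : Fin n) :
    0.9 * x ≤ incCount Y v ∧ incCount Y v ≤ 2 * x := by
  have h0 : (0 : ℝ) ≤ Aᶜ.indicator 1 (SimpleGraph.fromEdgeSet (Y : Set (Sym2 (Fin n)))) :=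
    Set.indicator_nonneg (fun _ _ ↦ zero_le_one) _
  have h1 := single_le_sum (f := fun v ↦ Real.exp (0.09 * x) * Real.exp (-0.1 * incCount Y v) +
    Real.exp (-2 * x) * Real.exp (1 * incCount Y v)) (fun w _ ↦ by positivity) (mem_univ v)
  rw [badWeight] at h
  simp only [← Real.exp_add] at h1 h
  constructor
  · by_contra! hlt
    have h2 := Real.one_le_exp (x := 0.09 * x + -0.1 * incCount Y v) (by linarith)
    linarith [Real.exp_pos (-2 * x + 1 * incCount Y v)]
  · by_contra! hlt
    have h2 := Real.one_le_exp (x := -2 * x + 1 * incCount Y v) (by linarith)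
    linarith [Real.exp_pos (0.09 * x + -0.1 * incCount Y v)]

end badWeight

/-! ### Numerical estimates -/

lemma one_add_pow_le_exp {p c : ℝ} (k : ℕ) (h : 0 ≤ 1 + p * c) :
    (1 + p * c) ^ k ≤ Real.exp (k * (p * c)) := by
  rw [Real.exp_nat_mul]
  exact pow_le_pow_left₀ h (by linarith [Real.add_one_le_exp (p * c)]) k

lemma exp_neg_tenth_le : Real.exp (-0.1) ≤ 0.905 := by
  have h1 := Real.quadratic_le_exp_of_nonneg (x := 0.1) (by norm_num)
  rw [Real.exp_neg, inv_le_comm₀ (Real.exp_pos _) (by norm_num)]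
  norm_num at h1 ⊢
  linarith

/-- The random graph is bad with probability at most `1 / 2`. The lower tail of the degrees needs
`n p` to be a large multiple of `log n`. -/
lemma condMean_badWeight_le {n : ℕ} {A : Set (SimpleGraph (Fin n))} {p : unitInterval}
    (hA : (SimpleGraph.binomialRandom (Fin n) p).real Aᶜ ≤ 1 / 4)
    (hn : 20 ≤ Real.log n) (hp : 10 ^ 5 * Real.log n ≤ n * (p : ℝ)) :
    condMean (p : ℝ) (badWeight A (n * p)) (allPairs n) ∅ ≤ 1 / 2 := by
  classical
  have hp0 : (0 : ℝ) ≤ p := p.2.1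
  have hp1 : (p : ℝ) ≤ 1 := p.2.2
  have he := Real.exp_one_lt_d9
  have he1 : 1 ≤ Real.exp 1 := Real.one_le_exp zero_le_one
  have hnpos : (0 : ℝ) < n := by
    rcases Nat.eq_zero_or_pos n with rfl | h
    · norm_num at hn
    · exact_mod_cast h
  have hlow : ∀ v : Fin n, condMean (p : ℝ) (fun Y ↦ Real.exp (0.09 * (n * p)) *
      Real.exp (-0.1 * incCount Y v)) (allPairs n) ∅ ≤ Real.exp (-2 * Real.log n) := by
    intro v
    have hk : (incCount (allPairs n) v : ℝ) + 1 = n := by exact_mod_cast incCount_allPairs_add_one v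
    rw [condMean_const_mul]
    unfold incCount
    rw [condMean_exp _ _ _ _ (disjoint_empty_right _)]
    have h0 : 0 ≤ 1 + (p : ℝ) * (Real.exp (-0.1) - 1) := by
      nlinarith [Real.exp_pos (-0.1)]
    have h1 := one_add_pow_le_exp (incCount (allPairs n) v) h0
    simp only [filter_empty, card_empty, Nat.cast_zero, mul_zero, Real.exp_zero, one_mul]
    refine (mul_le_mul_of_nonneg_left h1 (Real.exp_pos _).le).trans ?_
    rw [← Real.exp_add]
    refine Real.exp_le_exp.2 ?_
    have h2 : (incCount (allPairs n) v : ℝ) = n - 1 := by linarith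
    have h3 : (incCount (allPairs n) v : ℝ) * (p * (Real.exp (-0.1) - 1)) ≤
        incCount (allPairs n) v * (p * (-0.095)) := by
      gcongr
      linarith [exp_neg_tenth_le]
    rw [h2] at h3
    rw [h2]
    nlinarith
  have hupp : ∀ v : Fin n, condMean (p : ℝ) (fun Y ↦ Real.exp (-2 * (n * p)) *
      Real.exp (1 * incCount Y v)) (allPairs n) ∅ ≤ Real.exp (-2 * Real.log n) := by
    intro v
    have hk : (incCount (allPairs n) v : ℝ) + 1 = n := by exact_mod_cast incCount_allPairs_add_one v
    rw [condMean_const_mul]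
    unfold incCount
    rw [condMean_exp _ _ _ _ (disjoint_empty_right _)]
    have h0 : 0 ≤ 1 + (p : ℝ) * (Real.exp 1 - 1) := by nlinarith
    have h1 := one_add_pow_le_exp (incCount (allPairs n) v) h0
    simp only [filter_empty, card_empty, Nat.cast_zero, mul_zero, Real.exp_zero, one_mul]
    refine (mul_le_mul_of_nonneg_left h1 (Real.exp_pos _).le).trans ?_
    rw [← Real.exp_add]
    refine Real.exp_le_exp.2 ?_
    have h3 : (incCount (allPairs n) v : ℝ) * (p * (Real.exp 1 - 1)) ≤ n * (p * 1.72) := by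
      refine mul_le_mul (by linarith) ?_ (by nlinarith) hnpos.le
      exact mul_le_mul_of_nonneg_left (by linarith) hp0
    nlinarith
  have hsmall : n * (Real.exp (-2 * Real.log n) + Real.exp (-2 * Real.log n)) ≤ 1 / 4 := by
    have h1 : (n : ℝ) * Real.exp (-2 * Real.log n) = Real.exp (-Real.log n) := by
      nth_rewrite 1 [← Real.exp_log hnpos]
      rw [← Real.exp_add]
      congr 1
      ring
    have h2 : Real.exp (-Real.log n) ≤ 1 / 8 := by
      rw [Real.exp_neg, inv_le_comm₀ (Real.exp_pos _) (by norm_num)]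
      have := Real.add_one_le_exp (Real.log n)
      norm_num
      linarith
    nlinarith
  unfold badWeight
  rw [condMean_add, condMean_sum]
  simp only [condMean_add]
  have h1 := condMean_indicator_le n p Aᶜ
  have h2 : ∑ v : Fin n, (condMean (p : ℝ) (fun Y ↦ Real.exp (0.09 * (n * p)) *
        Real.exp (-0.1 * incCount Y v)) (allPairs n) ∅ +
      condMean (p : ℝ) (fun Y ↦ Real.exp (-2 * (n * p)) *
        Real.exp (1 * incCount Y v)) (allPairs n) ∅) ≤
      n * (Real.exp (-2 * Real.log n) + Real.exp (-2 * Real.log n)) := by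
    refine (sum_le_sum fun v _ ↦ add_le_add (hlow v) (hupp v)).trans_eq ?_
    simp only [sum_const, card_univ, Fintype.card_fin, nsmul_eq_mul]
  linarith

/-- The exposure in which no pair has been exposed. -/
def initialExposure (n : ℕ) : Exposure (Fin n) := ⟨allPairs n, ∅, ∅⟩

/-- The martingales for the lost edges are small at the start: each is at most
`exp (-(3.6 - 1.3 * 1.72) ε n p)`, and `ε n p ≥ log n`. -/
lemma sum_lossWeight_initial_le {n : ℕ} {p ε : ℝ} (hp0 : 0 ≤ p) (hε : 0 < ε)
    (hn : 20 ≤ Real.log n) (hp : Real.log n ≤ ε * (n * p)) :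
    ∑ v, (initialExposure n).lossWeight p (3.6 * (ε * (n * p))) (1.3 * (ε * n)) v ≤ 1 / 4 := by
  have he := Real.exp_one_lt_d9
  have he1 : 1 ≤ Real.exp 1 := Real.one_le_exp zero_le_one
  have hnpos : (0 : ℝ) < n := by
    rcases Nat.eq_zero_or_pos n with rfl | h
    · norm_num at hn
    · exact_mod_cast h
  have h1 : ∀ v, (initialExposure n).lossWeight p (3.6 * (ε * (n * p))) (1.3 * (ε * n)) v ≤
      Real.exp (-1.3 * Real.log n) := by
    intro v
    refine Real.exp_le_exp.2 ?_
    have hlog : Real.log (1 + p * (Real.exp 1 - 1)) ≤ p * 1.72 := by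
      have := Real.log_le_sub_one_of_pos (x := 1 + p * (Real.exp 1 - 1)) (by nlinarith)
      nlinarith
    have h2 := mul_le_mul_of_nonneg_left hlog (by positivity : 0 ≤ 1.3 * (ε * n))
    simp [initialExposure, incCount]
    nlinarith
  refine (sum_le_sum fun v _ ↦ h1 v).trans ?_
  simp only [sum_const, card_univ, Fintype.card_fin, nsmul_eq_mul]
  nth_rewrite 1 [← Real.exp_log hnpos]
  rw [← Real.exp_add]
  have h3 : Real.log n + -1.3 * Real.log n ≤ -6 := by linarith
  refine (Real.exp_le_exp.2 h3).trans ?_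
  rw [Real.exp_neg, inv_le_comm₀ (Real.exp_pos _) (by norm_num)]
  have := Real.add_one_le_exp (6 : ℝ)
  norm_num
  linarith

/-! ### The end and the beginning of the strategy -/

open Classical in
/-- When all pairs have been exposed, Walker's graph contains the random graph up to a small
proportion of the edges at every vertex. -/
lemma comap_mem_of_invariant {U : Type*} {P : GraphProperty} (hmono : P.IsMonotone) {n : ℕ}
    {φ : Fin n ↪ U} {d : ℕ} {p ε β C : ℝ} (hp : 0 ≤ p) (hε : 0 < ε) (hβ : 0 < β)
    (hK : ε * n + 2 * β * (2 * (n * p)) + (4 * β * Real.log C + β) ≤ 1.3 * (ε * n))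
    {X : Exposure (Fin n)} {S : State U}
    (h : Invariant φ d p (3.6 * (ε * (n * p))) (1.3 * (ε * n))
      (badWeight (robustGraphs P (4 * ε) n) (n * p)) (ε * n) β C X S) (hX : X.hidden = ∅) :
    S.W.comap φ ∈ P n := by
  have hrisk := h.risk_lt
  rw [Exposure.risk, hX, condMean_empty] at hrisk
  have hloss0 : 0 ≤ ∑ v, X.lossWeight p (3.6 * (ε * (n * p))) (1.3 * (ε * n)) v :=
    sum_nonneg fun v _ ↦ X.lossWeight_nonneg _ _ _ v
  have hbad : badWeight (robustGraphs P (4 * ε) n) (n * p) X.found < 1 := by linarith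
  have hbad0 : 0 ≤ badWeight (robustGraphs P (4 * ε) n) (n * p) X.found := badWeight_nonneg
  have hlost : ∀ v, (incCount (X.found ∩ X.blocked) v : ℝ) ≤ 3.6 * (ε * (n * p)) := by
    intro v
    by_contra! hlt
    have h1 : X.lossWeight p (3.6 * (ε * (n * p))) (1.3 * (ε * n)) v < 1 :=
      (single_le_sum (fun w _ ↦ X.lossWeight_nonneg _ _ _ w) (mem_univ v)).trans_lt
        (by linarith)
    have h2 : (incCount X.blocked v : ℝ) ≤ 1.3 * (ε * n) := by
      have h3 := (incCount_bounds_of_badWeight_lt hbad v).2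
      have h4 := h.blocked_le v
      nlinarith
    have h5 : 0 ≤ Real.log (1 + p * (Real.exp 1 - 1)) :=
      Real.log_nonneg (by nlinarith [Real.one_le_exp zero_le_one])
    refine absurd h1 (not_lt.2 (Real.one_le_exp ?_))
    nlinarith
  have hdiag : ∀ e ∈ X.found, ¬ e.IsDiag := by
    intro e he
    by_cases hb : e ∈ X.blocked
    · exact SimpleGraph.not_isDiag_of_mem_edgeSet _ (h.mem_breaker e hb)
    · exact SimpleGraph.not_isDiag_of_mem_edgeSet _ (h.mem_walker e he hb)
  set G := SimpleGraph.fromEdgeSet (X.found : Set (Sym2 (Fin n))) with hG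
  have hrob : G ∈ robustGraphs P (4 * ε) n := mem_of_badWeight_lt hbad
  refine hmono n _ _ sdiff_sdiff_le (hrob (G \ S.W.comap φ) sdiff_le fun v ↦ ?_)
  rw [← SimpleGraph.card_neighborSet_eq_degree, ← SimpleGraph.card_neighborSet_eq_degree,
    Fintype.card_eq_nat_card, Fintype.card_eq_nat_card, Nat.card_coe_set_eq, Nat.card_coe_set_eq]
  have h1 : (((G \ S.W.comap φ).neighborSet v).ncard : ℝ) ≤ incCount (X.found ∩ X.blocked) v := by
    refine Nat.cast_le.2 (ncard_neighborSet_le_incCount (fun e he ↦ ?_) v)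
    rw [SimpleGraph.edgeSet_sdiff, hG, SimpleGraph.edgeSet_fromEdgeSet] at he
    refine mem_inter.2 ⟨he.1.1, ?_⟩
    by_contra hb
    exact he.2 (h.mem_walker e he.1.1 hb)
  have h2 : (incCount X.found v : ℝ) ≤ (G.neighborSet v).ncard := by
    refine Nat.cast_le.2 (incCount_le_ncard_neighborSet (fun e he ↦ ?_) v)
    rw [hG, SimpleGraph.edgeSet_fromEdgeSet]
    exact ⟨he, hdiag e he⟩
  have h3 := (incCount_bounds_of_badWeight_lt hbad v).1
  nlinarith [hlost v]

open Classical in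
/-- If the free graph has minimum degree at least `(1 - ε) n`, then Breaker's degrees are at most
`ε n`. -/
lemma breakerDegree_le {U : Type*} {n : ℕ} {φ : Fin n ↪ U} {S : State U} {ε : ℝ}
    (h : (1 - ε) * (n : ℝ) ≤ ((S.free.comap φ).minDegree : ℝ)) (v : Fin n) :
    (breakerDegree φ S.B v : ℝ) ≤ ε * n := by
  have h1 : ((S.free.comap φ).minDegree : ℝ) ≤ ((S.free.comap φ).neighborSet v).ncard := by
    refine Nat.cast_le.2 ((SimpleGraph.minDegree_le_degree _ v).trans_eq ?_)
    rw [← SimpleGraph.card_neighborSet_eq_degree, Fintype.card_eq_nat_card, Nat.card_coe_set_eq]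
  have h2 : breakerDegree φ S.B v + ((S.free.comap φ).neighborSet v).ncard ≤ n := by
    rw [breakerDegree, ← Set.ncard_union_eq]
    · simpa using Set.ncard_le_ncard (Set.subset_univ
        ((S.B.comap φ).neighborSet v ∪ (S.free.comap φ).neighborSet v))
    · rw [Set.disjoint_left]
      intro u hu hu'
      simp only [SimpleGraph.mem_neighborSet, SimpleGraph.comap_adj, State.free,
        SimpleGraph.compl_adj, SimpleGraph.sup_adj] at hu hu'
      exact hu'.2 (Or.inr hu)
  have h3 : (breakerDegree φ S.B v : ℝ) + ((S.free.comap φ).neighborSet v).ncard ≤ n := by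
    exact_mod_cast h2
  linarith

/-- The invariant holds at the start. The slack `β` in the bound for Breaker's degrees allows for a
move of Breaker before the first round. -/
lemma invariant_initial {U : Type*} {n : ℕ} {φ : Fin n ↪ U} {d : ℕ} {p T K : ℝ}
    {f : Finset (Sym2 (Fin n)) → ℝ} {a β : ℝ} (ha : 0 ≤ a) (hβ : 0 < β) {S : State U}
    (hn : 1 ≤ n) (hdis : Disjoint S.W S.B)
    (hpath : ∀ u v, HasShortPath S.W d (φ u) (φ v))
    (hpos : ∀ v, HasShortPath S.W d S.pos (φ v))
    (hrisk : (initialExposure n).risk p T K f < 1)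
    (hdeg : ∀ v, (breakerDegree φ S.B v : ℝ) ≤ a + β) :
    Invariant φ d p T K f a β (n * Real.exp 1) (initialExposure n) S := by
  have hn' : (1 : ℝ) ≤ n := by exact_mod_cast hn
  refine ⟨hdis, hpath, hpos, by simp [initialExposure, allPairs], disjoint_empty_right _,
    disjoint_empty_right _, by simp [initialExposure], by simp [initialExposure], hrisk, ?_, ?_⟩
  · refine (sum_le_univ_sum_of_nonneg fun v ↦ (Real.exp_pos _).le).trans ?_
    refine (sum_le_card_nsmul _ _ (Real.exp 1) fun v _ ↦ Real.exp_le_exp.2 ?_).trans_eq (by simp)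
    rw [danger, div_le_one (by positivity)]
    have : (0 : ℝ) ≤ incCount (initialExposure n).found v := by positivity
    nlinarith [hdeg v]
  · intro v
    have h1 : 0 ≤ Real.log (n * Real.exp 1) :=
      Real.log_nonneg (by nlinarith [Real.one_le_exp zero_le_one])
    simp only [initialExposure, incCount, filter_empty, card_empty, Nat.cast_zero, mul_zero,
      add_zero]
    positivity

end WalkerBreaker

end

open Classical WalkerBreaker in
/-- The game is played on the edges of the complete graph on `Fin m`; the graph `K_n` of the
theorem is the complete graph on the `n` vertices `φ 0, …, φ (n - 1)` of this board (the whole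
board, if `m = n` and `φ` is the identity). The paths in Walker's graph may leave `K_n`. -/
theorem theorem2p3 (ε : ℝ) (hε0 : 0 < ε) (hε : ε < 1 / 10 ^ 5)
    (p : ℕ → unitInterval) (P : GraphProperty)
    (hmono : P.IsMonotone) (hres : P.IsResilient p (4 * ε)) :
    ∃ N : ℕ, ∀ n : ℕ, N ≤ n → Real.log n / (ε * n) ≤ (p n : ℝ) →
      ∀ (d b : ℕ), (b : ℝ) ≤ ε / (30 * ((d : ℝ) + 1) * (p n : ℝ)) →
      ∀ (m : ℕ) (φ : Fin n ↪ Fin m) (S : State (Fin m)) (q : Player),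
        -- no edge is claimed by both players
        Disjoint S.W S.B →
        -- the graph of the free edges of `K_n` has minimum degree at least `(1 - ε) n`
        (1 - ε) * (n : ℝ) ≤ ((S.free.comap φ).minDegree : ℝ) →
        -- short paths between any two vertices of `K_n`, and from Walker's position to `K_n`
        (∀ u v : Fin n, HasShortPath S.W d (φ u) (φ v)) →
        (∀ v : Fin n, HasShortPath S.W d S.pos (φ v)) →
        -- Walker can continue such that her graph, restricted to `K_n`, is in `P`
        WalkerWins b (fun W' => W'.comap φ ∈ P n) q S := by
  have hrob : ∀ᶠ n in Filter.atTop, (SimpleGraph.binomialRandom (Fin n) (p n)).real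
      (robustGraphs P (4 * ε) n)ᶜ ≤ 1 / 4 := by
    have h1 : Filter.Tendsto (fun n ↦ (SimpleGraph.binomialRandom (Fin n) (p n)).real
        (robustGraphs P (4 * ε) n)) Filter.atTop (nhds 1) :=
      (ENNReal.tendsto_toReal ENNReal.one_ne_top).comp hres
    filter_upwards [h1.eventually_const_lt (by norm_num : (3 / 4 : ℝ) < 1)] with n hn
    have h2 : MeasurableSet (robustGraphs P (4 * ε) n) := measurableSet_of_finite _
    rw [MeasureTheory.probReal_compl_eq_one_sub h2]
    linarith
  have hlog : ∀ᶠ n : ℕ in Filter.atTop, 20 ≤ Real.log n :=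
    (Real.tendsto_log_atTop.comp tendsto_natCast_atTop_atTop).eventually_ge_atTop 20
  obtain ⟨N, hN⟩ := Filter.eventually_atTop.1 (hrob.and hlog)
  refine ⟨N, fun n hn hpn d b hb m φ S q hdis hmin hpath hpos ↦ ?_⟩
  obtain ⟨hA, hn20⟩ := hN n hn
  set x : ℝ := (p n : ℝ) with hx
  have hx1 : x ≤ 1 := (p n).2.2
  have hnpos : (0 : ℝ) < n := by
    rcases Nat.eq_zero_or_pos n with rfl | h
    · norm_num at hn20
    · exact_mod_cast h
  have hnx : Real.log n ≤ ε * (n * x) := by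
    rw [div_le_iff₀ (by positivity)] at hpn
    linarith
  have hx0 : 0 < x := by
    by_contra! h
    have : ε * (n * x) ≤ 0 :=
      mul_nonpos_of_nonneg_of_nonpos hε0.le (mul_nonpos_of_nonneg_of_nonpos hnpos.le h)
    linarith
  have hnx5 : 10 ^ 5 * Real.log n ≤ n * x := by
    have : 0 < n * x := by positivity
    nlinarith
  -- `β` bounds the sum of the increments of Breaker's degrees in a round of `d + 1` moves
  set β : ℝ := ε / (15 * x) with hβ_def
  have hβ : 0 < β := by positivity
  have hβx : β * x = ε / 15 := by rw [hβ_def]; field_simp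
  have hbβ : 2 * (b * (d + 1) : ℝ) ≤ β := by
    rw [le_div_iff₀ (by positivity)] at hb
    rw [hβ_def, le_div_iff₀ (by positivity)]
    linarith
  have hK : ε * n + 2 * β * (2 * (n * x)) + (4 * β * Real.log (n * Real.exp 1) + β) ≤
      1.3 * (ε * n) := by
    rw [Real.log_mul hnpos.ne' (Real.exp_pos _).ne', Real.log_exp]
    have h1 : 2 * β * (2 * (n * x)) = 4 / 15 * (ε * n) := by linear_combination 4 * n * hβx
    -- the logarithmic excess of the box game is at most about `ε * (ε n)`, and `ε` is small
    have h2 : β * Real.log n ≤ ε / 15 * (ε * n) := by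
      have := mul_le_mul_of_nonneg_left hnx hβ.le
      calc β * Real.log n ≤ β * (ε * (n * x)) := this
        _ = ε / 15 * (ε * n) := by linear_combination ε * n * hβx
    have h3 : 0 < ε * n := by positivity
    nlinarith
  have hrisk : (initialExposure n).risk x (3.6 * (ε * (n * x))) (1.3 * (ε * n))
      (badWeight (robustGraphs P (4 * ε) n) (n * x)) < 1 := by
    have h1 := condMean_badWeight_le hA hn20 hnx5
    have h2 := sum_lossWeight_initial_le hx0.le hε0 hn20 hnx
    rw [Exposure.risk]
    simp only [initialExposure] at h2 ⊢
    linarith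
  have hdeg := breakerDegree_le hmin
  have hwin : ∀ S' : State (Fin m), Disjoint S'.W S'.B →
      (∀ u v, HasShortPath S'.W d (φ u) (φ v)) → (∀ v, HasShortPath S'.W d S'.pos (φ v)) →
      (∀ v, (breakerDegree φ S'.B v : ℝ) ≤ ε * n + β) →
      WalkerWins b (fun W' => W'.comap φ ∈ P n) .walker S' := by
    intro S' h1 h2 h3 h4
    exact walkerWins_of_invariant hx0.le hx1 hβ hbβ
      (fun X T hT hX ↦ comap_mem_of_invariant hmono hx0.le hε0 hβ hK hT hX) _ _
      (invariant_initial (by positivity) hβ (by exact_mod_cast hnpos) h1 h2 h3 hrisk h4)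
  cases q with
  | walker => exact hwin S hdis hpath hpos fun v ↦ by linarith [hdeg v]
  | breaker =>
    refine .breakerMove _ fun E hE ↦ hwin _ (State.disjoint_claim hdis hE) hpath hpos fun v ↦ ?_
    have h1 : (breakerDegree φ (S.claim E).B v : ℝ) ≤
        breakerDegree φ S.B v + incCount E (φ v) := by
      exact_mod_cast breakerDegree_claim_le φ S.B E v
    have h2 : (incCount E (φ v) : ℝ) ≤ b := by
      exact_mod_cast (Finset.card_filter_le _ _).trans (hE.2.le.trans (min_le_left _ _))
    have h3 : (b : ℝ) ≤ b * (d + 1) := by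
      nlinarith [Nat.cast_nonneg (α := ℝ) b, Nat.cast_nonneg (α := ℝ) d]
    linarith [hdeg v]
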